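/- For a positive integer $m$ write $[m]=\{1,\dots,m\}$. A chain of length $\delta$ in $[m]$ is a nested sequence of sets $A_0\subseteq A_1\subseteq\cdots\subseteq A_\delta\subseteq[m]$ with $|A_0|=1$; writing $A_0=\{\alpha\}$, it is denoted $\langle\alpha,A_1,\dots,A_\delta\rangle$. Let $U(m,R,\delta)$ be the graph whose vertices are the chains of length $\delta$ in $[m]$ with $|A_\delta|\le R$, in which $\langle\alpha,A_1,\dots,A_\delta\rangle$ and $\langle\beta,B_1,\dots,B_\delta\rangle$ are adjacent if and only if $\alpha\ne\beta$, $\alpha\in B_1$, $\beta\in A_1$, and $A_i\subseteq B_{i+1}$ and $B_i\subseteq A_{i+1}$ for all $1\le i\le\delta-1$. For integers $\delta\ge1$ and $R\ge2\delta+1$, let $Z(m,R,\delta)$ be the subgraph of $U(m,R,\delta)$ induced by the chains with $|A_i|=2i+1$ for $1\le i\le\delta-1$ and $|A_\delta|=R$. Let $\log^{(j)}$ denote the base-2 logarithm iterated $j$ times, and let $\chi$ denote the chromatic number. Theorem. For all fixed integers $\delta\ge1$ and $R\ge2\delta+1$, as $m\to\infty$, $$\chi(Z(m,R,\delta))>2^{\frac{R-2\delta-4}{2}}\cdot\log^{(2\delta)}m+o(1);$$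 that is, there is a function $\varepsilon(m)$ with $\varepsilon(m)\to0$ as $m\to\infty$ (depending on $R$ and $\delta$) such that $\chi(Z(m,R,\delta))>2^{(R-2\delta-4)/2}\log^{(2\delta)}m+\varepsilon(m)$ for all sufficiently large $m$. -/

import Mathlib

open Filter Asymptotics

/-- A chain `⟨A_0, A_1, …, A_f⟩` of length `f` in an `N`-element universe: nested sets
`A_0 ⊆ A_1 ⊆ ⋯ ⊆ A_f ⊆ [N]` with `|A_0| = 1`. -/
structure Chain (N f : ℕ) where
  /-- the sets of the chain, `A.sets i` being `A_i` -/
  sets : Fin (f + 1) → Finset (Fin N)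
  nested : Monotone sets
  card_zero : (sets 0).card = 1

/-- The size `|A_f|` of a chain `⟨A_0, …, A_f⟩`. -/
def Chain.size {N f : ℕ} (A : Chain N f) : ℕ :=
  (A.sets (Fin.last f)).card

/-- The chain graph `U(m, R, δ)`. Its vertices are the chains of length `δ` and size at most `R`.
Two chains with `A_0 = {α}` and `B_0 = {β}` are adjacent iff `α ≠ β`, and `A_i ⊆ B_{i+1}` and
`B_i ⊆ A_{i+1}` for all `0 ≤ i ≤ δ - 1`; for `i = 0` the inclusions say `α ∈ B_1`, `β ∈ A_1`. -/
def graphU (m R δ : ℕ) : SimpleGraph {A : Chain m δ // A.size ≤ R} where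
  Adj A B := A.1.sets 0 ≠ B.1.sets 0 ∧
    ∀ i : Fin δ, A.1.sets i.castSucc ⊆ B.1.sets i.succ ∧ B.1.sets i.castSucc ⊆ A.1.sets i.succ
  symm := ⟨fun _ _ h => ⟨h.1.symm, fun i => ⟨(h.2 i).2, (h.2 i).1⟩⟩⟩
  loopless := ⟨fun _ h => h.1 rfl⟩

/-- The vertices of `Z(m, R, δ)`: the chains `⟨A_0, …, A_δ⟩` with `|A_i| = 2 i + 1` for
`1 ≤ i ≤ δ - 1` and `|A_δ| = R`. -/
def verticesZ (m R δ : ℕ) : Set {A : Chain m δ // A.size ≤ R} :=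
  {A | (∀ i : Fin (δ + 1), 1 ≤ (i : ℕ) → (i : ℕ) < δ → (A.1.sets i).card = 2 * (i : ℕ) + 1) ∧
    A.1.size = R}

/-- The graph `Z(m, R, δ)`, an induced subgraph of `U(m, R, δ)`. -/
def graphZ (m R δ : ℕ) : SimpleGraph (verticesZ m R δ) :=
  (graphU m R δ).induce (verticesZ m R δ)

/-- The base-2 logarithm iterated `j` times. -/
noncomputable def iterLog (j : ℕ) (x : ℝ) : ℝ :=
  (Real.logb 2)^[j] x

/-!
The chains used are built from increasing tuples `P = (a₁, …, a_{2δ-1})` in `[m]`: for `i < δ` the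
set `A_i` is the window of the `2 i + 1` middle entries of `P`, and the last set `A_δ` is any
`R`-element set containing `P`. Given a proper `k`-colouring, let `T(P, E)` be the set of colours of
those chains with `E ⊆ A_δ`. It shrinks as `E` grows, and it is nonempty as long as
`|E| ≤ s + 2`, where `s = R - 2δ - 1`. If `Q` is the shift of `P`, with new last entry `y` and lost
first entry `x`, then `T(P, E)` and `T(Q, F)` are disjoint whenever `y ∈ E` and `x ∈ F`, because
the corresponding chains are adjacent (`disjoint_extensionColors`).

For each `P`, add elements to `E` greedily so that each one halves `T(P, E)`
(`exists_small_or_stuck`). This ends with a set `E(P)` of at most `s` elements such that either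
`|T(P, E(P))| ≤ k / 2 ^ s` ("small"), or every further element keeps more than half of
`T(P, E(P))` ("stuck"). Colour `P` by the triple consisting of the alternative that occurs, the set
`T(P, E(P))`, and the family of all its subsets `T(P, E(P) ∪ {x})`. This is a proper colouring of
the shift graph on `(2δ-1)`-tuples:

* if `P` and its shift `Q` are both stuck with `T(P, E(P)) = T(Q, E(Q)) = X`, two disjoint subsets
  of `X` each have more than `|X| / 2` elements;
* if both are small with the same family, then `T(P, E(P) ∪ {y}) = T(Q, E(Q) ∪ {z})` for some `z`,
  and this set is disjoint from `T(Q, E(Q) ∪ {x})`, although `T(Q, E(Q) ∪ {x, z})` is nonempty.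

A family of subsets of a set of `⌊k / 2 ^ s⌋` elements is one of `2 ^ 2 ^ ⌊k / 2 ^ s⌋`, so at most
`2 ^ (k + 1 + 2 ^ ⌊k / 2 ^ s⌋)` colours are used. A shift graph on `n`-tuples with `N` colours
satisfies `log^(n-1) m ≤ N`, with iterated base-2 logarithms (`le_iterate_two_pow_of_shift_coloring`); hence
`log^(2δ-1) m ≤ k + 1 + 2 ^ (k / 2 ^ s)`. With `L = log^(2δ) m` this reads
`2 ^ L ≤ k + 1 + 2 ^ (k / 2 ^ s)`. The claimed constant `2 ^ ((s - 3) / 2)` is at most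
`2 ^ s / 2`, so `k` being at most the claimed bound would give `2 ^ L ≤ O(L) + 2 ^ (L / 2)`,
which fails for large `m`.
-/

/-! ### Shift graphs -/

/-- A proper colouring of the shift graph on the increasing `(n + 1)`-tuples of `[m]` needs so many
colours that their `n`-fold iterated exponential is at least `m`. Only the values of `f` on
increasing tuples matter. -/
theorem le_iterate_two_pow_of_shift_coloring {m : ℕ} (n : ℕ) {κ : Type} [Fintype κ]
    (f : (Fin (n + 1) → Fin m) → κ)
    (h : ∀ a : Fin (n + 2) → Fin m, StrictMono a → f (a ∘ Fin.castSucc) ≠ f (a ∘ Fin.succ)) :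
    m ≤ (fun x => 2 ^ x)^[n] (Fintype.card κ) := by
  classical
  induction n generalizing κ with
  | zero =>
    have hlt : ∀ x y : Fin m, x < y → f (fun _ => x) ≠ f (fun _ => y) := by
      intro x y hxy he
      refine h ![x, y] ?_ ?_
      · rw [Fin.strictMono_iff_lt_succ]
        intro i
        fin_cases i
        exact hxy
      · convert he using 2 <;> (funext i; fin_cases i; rfl)
    have hinj : Function.Injective (fun x : Fin m => f (fun _ => x)) := by
      intro x y hxy
      rcases lt_trichotomy x y with hlt' | heq | hgt
      · exact absurd hxy (hlt x y hlt')
      · exact heq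
      · exact absurd hxy.symm (hlt y x hgt)
    simpa using Fintype.card_le_of_injective _ hinj
  | succ n ih =>
    -- Colour an `n`-tuple by the set of colours of its extensions by one larger entry.
    let g : (Fin (n + 1) → Fin m) → Finset κ := fun b =>
      Finset.univ.filter fun x => ∃ a : Fin (n + 2) → Fin m, StrictMono a ∧
        a ∘ Fin.castSucc = b ∧ f a = x
    have hg := ih g (by
      intro a ha he
      have hmem : f a ∈ g (a ∘ Fin.castSucc) := by
        simp only [g, Finset.mem_filter, Finset.mem_univ, true_and]
        exact ⟨a, ha, rfl, rfl⟩
      rw [he] at hmem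
      simp only [g, Finset.mem_filter, Finset.mem_univ, true_and] at hmem
      obtain ⟨a', ha', hs, hf⟩ := hmem
      have hcomp : ∀ j : Fin (n + 1), a' j.castSucc = a j.succ := fun j => congrFun hs j
      let b : Fin (n + 3) → Fin m := Fin.cons (a 0) a'
      have hb1 : b ∘ Fin.castSucc = a := by
        funext j
        refine Fin.cases ?_ (fun j => ?_) j
        · rfl
        · simp only [Function.comp_apply, ← Fin.succ_castSucc, b, Fin.cons_succ, hcomp]
      have hb2 : b ∘ Fin.succ = a' := by
        funext j
        simp [b]
      refine h b ?_ ?_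
      · rw [Fin.strictMono_iff_lt_succ]
        intro i
        refine Fin.cases ?_ (fun i => ?_) i
        · have h0 : a' 0 = a 1 := hcomp 0
          have h1 : b (Fin.succ 0) = a' 0 := by simp [b]
          rw [h1, h0]
          exact ha (by simp)
        · simp only [← Fin.succ_castSucc, b, Fin.cons_succ]
          exact ha' (Fin.castSucc_lt_succ)
      · rw [hb1, hb2, hf])
    rw [Function.iterate_succ_apply]
    simpa using hg

/-! ### Windows and chains -/

/-- The `i`-th window of a `(2 d + 1)`-tuple `P`: the set of the `2 i + 1` middle entries of `P`. -/
def window {m d : ℕ} (P : Fin (2 * d + 1) → Fin m) (i : ℕ) : Finset (Fin m) :=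
  (Finset.univ.filter fun j : Fin (2 * d + 1) => d ≤ j + i ∧ (j : ℕ) ≤ d + i).image P

theorem mem_window {m d : ℕ} {P : Fin (2 * d + 1) → Fin m} {i : ℕ} {x : Fin m} :
    x ∈ window P i ↔ ∃ j : Fin (2 * d + 1), (d ≤ j + i ∧ (j : ℕ) ≤ d + i) ∧ P j = x := by
  simp [window]

theorem window_mono {m d : ℕ} (P : Fin (2 * d + 1) → Fin m) : Monotone (window P) := by
  intro i i' hi x hx
  rw [mem_window] at hx ⊢
  obtain ⟨j, hj, rfl⟩ := hx
  exact ⟨j, by omega, rfl⟩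

theorem card_window {m d : ℕ} {P : Fin (2 * d + 1) → Fin m} (hP : Function.Injective P) {i : ℕ}
    (hi : i ≤ d) : (window P i).card = 2 * i + 1 := by
  rw [window, Finset.card_image_of_injective _ hP]
  have : (Finset.univ.filter fun j : Fin (2 * d + 1) => d ≤ j + i ∧ (j : ℕ) ≤ d + i) =
      Finset.Icc (⟨d - i, by omega⟩ : Fin (2 * d + 1)) ⟨d + i, by omega⟩ := by
    ext j
    simp only [Finset.mem_filter, Finset.mem_univ, true_and, Finset.mem_Icc, Fin.le_def]
    omega
  rw [this, Fin.card_Icc]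
  simp only
  omega

theorem window_castSucc_subset {m d : ℕ} (a : Fin (2 * d + 2) → Fin m) {i : ℕ} (hi : i < d) :
    window (a ∘ Fin.castSucc) i ⊆ window (a ∘ Fin.succ) (i + 1) := by
  intro x hx
  rw [mem_window] at hx ⊢
  obtain ⟨j, hj, rfl⟩ := hx
  refine ⟨⟨j - 1, by omega⟩, by simp only; omega, ?_⟩
  simp only [Function.comp_apply]
  congr 1
  ext
  simp only [Fin.val_succ, Fin.val_castSucc]
  omega

theorem window_succ_subset {m d : ℕ} (a : Fin (2 * d + 2) → Fin m) {i : ℕ} (hi : i < d) :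
    window (a ∘ Fin.succ) i ⊆ window (a ∘ Fin.castSucc) (i + 1) := by
  intro x hx
  rw [mem_window] at hx ⊢
  obtain ⟨j, hj, rfl⟩ := hx
  refine ⟨⟨j + 1, by omega⟩, by simp only; omega, ?_⟩
  simp only [Function.comp_apply]
  congr 1

theorem window_castSucc_last {m d : ℕ} (a : Fin (2 * d + 2) → Fin m) :
    window (a ∘ Fin.castSucc) d ⊆ insert (a 0) (window (a ∘ Fin.succ) d) := by
  intro x hx
  rw [mem_window] at hx
  obtain ⟨j, hj, rfl⟩ := hx
  rw [Finset.mem_insert, mem_window]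
  rcases Nat.eq_zero_or_pos (j : ℕ) with h0 | h0
  · left
    simp only [Function.comp_apply]
    congr 1
    ext
    simpa using h0
  · right
    refine ⟨⟨j - 1, by omega⟩, by simp only; omega, ?_⟩
    simp only [Function.comp_apply]
    congr 1
    ext
    simp only [Fin.val_succ, Fin.val_castSucc]
    omega

theorem window_succ_last {m d : ℕ} (a : Fin (2 * d + 2) → Fin m) :
    window (a ∘ Fin.succ) d ⊆ insert (a (Fin.last _)) (window (a ∘ Fin.castSucc) d) := by
  intro x hx
  rw [mem_window] at hx
  obtain ⟨j, hj, rfl⟩ := hx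
  rw [Finset.mem_insert, mem_window]
  rcases Nat.lt_or_ge (j : ℕ) (2 * d) with h0 | h0
  · right
    refine ⟨⟨j + 1, by omega⟩, by simp only; omega, ?_⟩
    simp only [Function.comp_apply]
    congr 1
  · left
    simp only [Function.comp_apply]
    congr 1
    ext
    simp only [Fin.val_succ, Fin.val_last]
    omega

/-- Every increasing tuple `P` and every small enough set `E` are carried by a vertex of the
graph whose sets are the windows of `P` followed by a superset of `E`. -/
theorem exists_chain_extending_windows {m R d : ℕ} {P : Fin (2 * d + 1) → Fin m}
    (hP : Function.Injective P) {E : Finset (Fin m)} (hE : E.card + (2 * d + 1) ≤ R)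
    (hm : R ≤ m) :
    ∃ A : verticesZ m R (d + 1),
      (∀ i : Fin (d + 1), A.1.1.sets i.castSucc = window P i) ∧
        E ⊆ A.1.1.sets (Fin.last _) := by
  classical
  obtain ⟨B, hB, -, hcard⟩ := Finset.exists_subsuperset_card_eq (n := R)
    (Finset.subset_univ (E ∪ window P d))
    ((Finset.card_union_le _ _).trans (by rw [card_window hP le_rfl]; exact hE))
    (by simpa using hm)
  let S : Fin (d + 2) → Finset (Fin m) := fun i => if (i : ℕ) ≤ d then window P i else B
  have hS : ∀ i : Fin (d + 1), S i.castSucc = window P i := by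
    intro i
    have hi : (i : ℕ) ≤ d := Nat.lt_succ_iff.mp i.2
    simp [S, hi]
  have hlast : S (Fin.last _) = B := by simp [S]
  have hmono : Monotone S := by
    intro i j hij
    rw [Fin.le_def] at hij
    by_cases hj : (j : ℕ) ≤ d
    · simp only [S, hj, hij.trans hj, if_true]
      exact window_mono P hij
    · by_cases hi : (i : ℕ) ≤ d
      · simp only [S, hj, hi, if_true, if_false]
        exact (window_mono P hi).trans (Finset.union_subset_right hB)
      · simp [S, hj, hi]
  have hzero : (S 0).card = 1 := by
    have := hS 0
    rw [Fin.castSucc_zero] at this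
    rw [this, card_window hP (by simp)]
    simp
  let C : Chain m (d + 1) := ⟨S, hmono, hzero⟩
  have hsize : C.size = R := (congrArg Finset.card hlast).trans hcard
  refine ⟨⟨⟨C, hsize.le⟩, ?_, hsize⟩, hS, ?_⟩
  · intro i _ hi
    have hi' : (i : ℕ) ≤ d := Nat.lt_succ_iff.mp hi
    change (S i).card = _
    simp only [S, hi', if_true]
    exact card_window hP hi'
  · change E ⊆ S (Fin.last _)
    rw [hlast]
    exact Finset.union_subset_left hB

/-- Two chains built on the windows of a tuple and of its shift are adjacent as soon as their last
sets contain the entry that the other tuple has in addition. -/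
theorem adj_of_shifted_windows {m R d : ℕ} {a : Fin (2 * d + 2) → Fin m} (ha : StrictMono a)
    {A B : verticesZ m R (d + 1)}
    (hA : ∀ i : Fin (d + 1), A.1.1.sets i.castSucc = window (a ∘ Fin.castSucc) i)
    (hB : ∀ i : Fin (d + 1), B.1.1.sets i.castSucc = window (a ∘ Fin.succ) i)
    (hAl : a (Fin.last _) ∈ A.1.1.sets (Fin.last _)) (hBl : a 0 ∈ B.1.1.sets (Fin.last _)) :
    (graphZ m R (d + 1)).Adj A B := by
  classical
  refine ⟨?_, ?_⟩
  · intro he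
    have h1 := hA 0
    have h2 := hB 0
    rw [Fin.castSucc_zero] at h1 h2
    have hmem : a (Fin.castSucc ⟨d, by omega⟩) ∈ window (a ∘ Fin.castSucc) 0 :=
      mem_window.2 ⟨⟨d, by omega⟩, by simp, rfl⟩
    have he' : window (a ∘ Fin.castSucc) 0 = window (a ∘ Fin.succ) 0 := h1.symm.trans (he.trans h2)
    rw [he', mem_window] at hmem
    obtain ⟨j, hj, hj'⟩ := hmem
    have := congrArg Fin.val (ha.injective hj')
    simp only [Fin.val_succ, Fin.val_castSucc] at this
    omega
  · intro i
    change A.1.1.sets i.castSucc ⊆ B.1.1.sets i.succ ∧ B.1.1.sets i.castSucc ⊆ A.1.1.sets i.succ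
    rw [hA i, hB i]
    refine Fin.lastCases ?_ (fun i => ?_) i
    · have hAd : window (a ∘ Fin.castSucc) d ⊆ A.1.1.sets (Fin.last _) := by
        have := hA (Fin.last d)
        rw [Fin.val_last] at this
        rw [← this]
        exact A.1.1.nested (Fin.le_last _)
      have hBd : window (a ∘ Fin.succ) d ⊆ B.1.1.sets (Fin.last _) := by
        have := hB (Fin.last d)
        rw [Fin.val_last] at this
        rw [← this]
        exact B.1.1.nested (Fin.le_last _)
      rw [Fin.succ_last, Fin.val_last]
      exact ⟨(window_castSucc_last a).trans (Finset.insert_subset hBl hBd),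
        (window_succ_last a).trans (Finset.insert_subset hAl hAd)⟩
    · have e1 := hA i.succ
      have e2 := hB i.succ
      rw [← Fin.succ_castSucc, Fin.val_succ] at e1 e2
      rw [e1, e2, Fin.val_castSucc]
      exact ⟨window_castSucc_subset a i.2, window_succ_subset a i.2⟩

/-! ### Colours of the extensions of a tuple -/

open Classical in
/-- The colours that `c` uses on the chains whose sets before the last are the windows of `P` and
whose last set contains `E`. -/
noncomputable def extensionColors {m R d k : ℕ} (c : (graphZ m R (d + 1)).Coloring (Fin k))
    (P : Fin (2 * d + 1) → Fin m) (E : Finset (Fin m)) : Finset (Fin k) :=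
  Finset.univ.filter fun x => ∃ A : verticesZ m R (d + 1),
    (∀ i : Fin (d + 1), A.1.1.sets i.castSucc = window P i) ∧ E ⊆ A.1.1.sets (Fin.last _) ∧ c A = x

section extensionColors

variable {m R d k : ℕ} (c : (graphZ m R (d + 1)).Coloring (Fin k))

theorem mem_extensionColors {P : Fin (2 * d + 1) → Fin m} {E : Finset (Fin m)} {x : Fin k} :
    x ∈ extensionColors c P E ↔ ∃ A : verticesZ m R (d + 1),
      (∀ i : Fin (d + 1), A.1.1.sets i.castSucc = window P i) ∧
        E ⊆ A.1.1.sets (Fin.last _) ∧ c A = x := by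
  simp [extensionColors]

theorem extensionColors_antitone (P : Fin (2 * d + 1) → Fin m) :
    Antitone (extensionColors c P) := by
  intro E F hEF x hx
  rw [mem_extensionColors] at hx ⊢
  obtain ⟨A, h1, h2, h3⟩ := hx
  exact ⟨A, h1, hEF.trans h2, h3⟩

theorem extensionColors_nonempty {P : Fin (2 * d + 1) → Fin m} (hP : Function.Injective P)
    {E : Finset (Fin m)} (hE : E.card + (2 * d + 1) ≤ R) (hm : R ≤ m) :
    (extensionColors c P E).Nonempty := by
  obtain ⟨A, h1, h2⟩ := exists_chain_extending_windows hP hE hm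
  exact ⟨c A, (mem_extensionColors c).2 ⟨A, h1, h2, rfl⟩⟩

theorem disjoint_extensionColors {a : Fin (2 * d + 2) → Fin m} (ha : StrictMono a)
    {E F : Finset (Fin m)} (hE : a (Fin.last _) ∈ E) (hF : a 0 ∈ F) :
    Disjoint (extensionColors c (a ∘ Fin.castSucc) E) (extensionColors c (a ∘ Fin.succ) F) := by
  rw [Finset.disjoint_left]
  intro x hx hy
  rw [mem_extensionColors] at hx hy
  obtain ⟨A, hA, hAE, rfl⟩ := hx
  obtain ⟨B, hB, hBF, hAB⟩ := hy
  exact c.valid (adj_of_shifted_windows ha hA hB (hAE hE) (hBF hF)) hAB.symm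

end extensionColors

/-- Greedy halving: adding at most `s` elements one at a time, either each step can be made to halve
the set `T E`, or some `E` is reached from which no single element halves it. -/
theorem exists_small_or_stuck {α β : Type*} [DecidableEq α] (T : Finset α → Finset β) {k : ℕ}
    (hT : (T ∅).card ≤ k) (s : ℕ) :
    ∃ E : Finset α, E.card ≤ s ∧
      (2 ^ s * (T E).card ≤ k ∨ ∀ x, (T E).card < 2 * (T (insert x E)).card) := by
  induction s with
  | zero => exact ⟨∅, by simp, Or.inl (by simpa using hT)⟩
  | succ s ih =>
    obtain ⟨E, hE, h | h⟩ := ih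
    · by_cases hst : ∀ x, (T E).card < 2 * (T (insert x E)).card
      · exact ⟨E, by omega, Or.inr hst⟩
      · push Not at hst
        obtain ⟨x, hx⟩ := hst
        refine ⟨insert x E, (Finset.card_insert_le _ _).trans (by omega), Or.inl ?_⟩
        calc 2 ^ (s + 1) * (T (insert x E)).card
            = 2 ^ s * (2 * (T (insert x E)).card) := by ring
          _ ≤ 2 ^ s * (T E).card := Nat.mul_le_mul_left _ hx
          _ ≤ k := h
    · exact ⟨E, by omega, Or.inr h⟩

theorem exists_injOn_powerset {k t : ℕ} (X : Finset (Fin k)) :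
    ∃ φ : Finset (Fin k) → Finset (Fin t), X.card ≤ t → Set.InjOn φ X.powerset := by
  by_cases h : X.card ≤ t
  · obtain ⟨φ, -, hφ⟩ := Set.Finite.exists_injOn_of_encard_le
      (s := (X.powerset : Set (Finset (Fin k)))) (t := (Set.univ : Set (Finset (Fin t))))
      (Finset.finite_toSet _) (by
        rw [Set.encard_coe_eq_coe_finsetCard, Finset.card_powerset, ← Finset.coe_univ,
          Set.encard_coe_eq_coe_finsetCard]
        simp only [Finset.card_univ, Fintype.card_finset, Fintype.card_fin]
        exact_mod_cast Nat.pow_le_pow_right two_pos h)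
    exact ⟨φ, fun _ => hφ⟩
  · exact ⟨fun _ => ∅, fun h' => absurd h' h⟩

/-- A proper `k`-colouring of the graph gives a proper colouring of the shift graph on
`(2 d + 1)`-tuples with `2 ^ (k + 1 + 2 ^ t)` colours, where `t = ⌊k / 2 ^ s⌋`, whence the bound. -/
theorem le_iterate_two_pow_of_coloring {m d s k : ℕ} (hm : 2 * d + 3 + s ≤ m)
    (c : (graphZ m (2 * d + 3 + s) (d + 1)).Coloring (Fin k)) :
    m ≤ (fun x => 2 ^ x)^[2 * d] (2 ^ (k + 1 + 2 ^ (k / 2 ^ s))) := by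
  classical
  set t := k / 2 ^ s with ht
  set T := extensionColors c with hTdef
  have hchoice : ∀ P, ∃ E : Finset (Fin m), E.card ≤ s ∧
      (2 ^ s * (T P E).card ≤ k ∨ ∀ x, (T P E).card < 2 * (T P (insert x E)).card) := fun P =>
    exists_small_or_stuck (T P) ((Finset.card_le_univ _).trans (by simp)) s
  choose E hEcard hE using hchoice
  choose φ hφ using fun X : Finset (Fin k) => exists_injOn_powerset (t := t) X
  -- The subsets of a small `T P (E P)` are encoded as subsets of `Fin t`.
  let f : (Fin (2 * d + 1) → Fin m) → Bool × Finset (Fin k) × Finset (Finset (Fin t)) := fun P =>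
    (decide (2 ^ s * (T P (E P)).card ≤ k), T P (E P),
      Finset.univ.image fun x => φ (T P (E P)) (T P (insert x (E P))))
  have key := le_iterate_two_pow_of_shift_coloring (2 * d) f (by
    intro a ha he
    set P := a ∘ Fin.castSucc with hP
    set Q := a ∘ Fin.succ with hQ
    simp only [f, Prod.mk.injEq] at he
    obtain ⟨he1, he2, he3⟩ := he
    rw [decide_eq_decide] at he1
    have hdisj : ∀ {F G : Finset (Fin m)}, a (Fin.last _) ∈ F → a 0 ∈ G →
        Disjoint (T P F) (T Q G) := fun hF hG => disjoint_extensionColors c ha hF hG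
    have hQinj : Function.Injective Q := ha.injective.comp (Fin.succ_injective _)
    by_cases hsmall : 2 ^ s * (T P (E P)).card ≤ k
    · have hXt : (T P (E P)).card ≤ t := by
        rw [ht, Nat.le_div_iff_mul_le (by positivity), mul_comm]
        exact hsmall
      have hmem : φ (T P (E P)) (T P (insert (a (Fin.last _)) (E P))) ∈
          Finset.univ.image fun x => φ (T P (E P)) (T P (insert x (E P))) :=
        Finset.mem_image_of_mem _ (Finset.mem_univ _)
      rw [he3, Finset.mem_image] at hmem
      obtain ⟨x, -, hx⟩ := hmem
      rw [← he2] at hx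
      have hx' := hφ _ hXt
        (by
          rw [Finset.mem_coe, Finset.mem_powerset, he2]
          exact extensionColors_antitone c Q (Finset.subset_insert _ _))
        (by
          rw [Finset.mem_coe, Finset.mem_powerset]
          exact extensionColors_antitone c P (Finset.subset_insert _ _)) hx
      obtain ⟨y, hy⟩ := extensionColors_nonempty c hQinj
        (E := insert (a 0) (insert x (E Q))) (by
          have h1 := Finset.card_insert_le (a 0) (insert x (E Q))
          have h2 := Finset.card_insert_le x (E Q)
          have h3 := hEcard Q
          omega) hm
      have hy1 : y ∈ T Q (insert x (E Q)) :=
        extensionColors_antitone c Q (Finset.subset_insert _ _) hy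
      rw [hx'] at hy1
      exact Finset.disjoint_left.1
        (hdisj (Finset.mem_insert_self _ _) (Finset.mem_insert_self _ _)) hy1 hy
    · -- Both tuples are stuck, so two disjoint sets fill more than half of the same set each.
      have hPs := ((hE P).resolve_left hsmall) (a (Fin.last _))
      have hQs := ((hE Q).resolve_left (fun h => hsmall (he1.2 h))) (a 0)
      have hsub : T P (insert (a (Fin.last _)) (E P)) ∪ T Q (insert (a 0) (E Q)) ⊆ T P (E P) :=
        Finset.union_subset (extensionColors_antitone c P (Finset.subset_insert _ _)) (by
          rw [he2]
          exact extensionColors_antitone c Q (Finset.subset_insert _ _))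
      have hcard := Finset.card_le_card hsub
      rw [Finset.card_union_of_disjoint
        (hdisj (Finset.mem_insert_self _ _) (Finset.mem_insert_self _ _))] at hcard
      rw [← he2] at hQs
      omega)
  have hκ : Fintype.card (Bool × Finset (Fin k) × Finset (Finset (Fin t))) =
      2 ^ (k + 1 + 2 ^ t) := by
    simp only [Fintype.card_prod, Fintype.card_bool, Fintype.card_finset, Fintype.card_fin]
    ring
  rwa [hκ] at key

/-! ### Iterated logarithms -/

theorem tendsto_iterLog_atTop (j : ℕ) : Tendsto (iterLog j) atTop atTop := by
  induction j with
  | zero => exact tendsto_id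
  | succ j ih =>
    have : iterLog (j + 1) = Real.logb 2 ∘ iterLog j := by
      funext x
      simp only [iterLog, Function.iterate_succ_apply', Function.comp_apply]
    rw [this]
    exact (Real.tendsto_logb_atTop one_lt_two).comp ih

theorem iterLog_le_of_le_iterate_two_pow {j m y : ℕ} (hpos : ∀ i < j, 0 < iterLog i (m : ℝ))
    (h : m ≤ (fun x => 2 ^ x)^[j] y) : iterLog j (m : ℝ) ≤ y := by
  suffices H : ∀ i ≤ j, iterLog i (m : ℝ) ≤ (((fun x => 2 ^ x)^[j - i] y : ℕ) : ℝ) by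
    simpa using H j le_rfl
  intro i hi
  induction i with
  | zero => simpa [iterLog] using (Nat.cast_le (α := ℝ)).2 h
  | succ i ih =>
    have h1 := ih (by omega)
    have h2 : j - i = (j - (i + 1)) + 1 := by omega
    rw [h2, Function.iterate_succ_apply'] at h1
    push_cast at h1
    have h3 := Real.logb_le_logb_of_le one_lt_two (hpos i (by omega)) h1
    rw [Real.logb_pow, Real.logb_self_eq_one one_lt_two, mul_one] at h3
    simpa only [iterLog, Function.iterate_succ_apply'] using h3

theorem eventually_add_two_rpow_half_lt (C : ℝ) :
    ∀ᶠ x : ℝ in atTop, C * x + 1 + (2 : ℝ) ^ (x / 2) < (2 : ℝ) ^ x := by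
  have hlog : 0 < Real.log 2 / 2 := by have := Real.log_pos one_lt_two; positivity
  have ho := (isLittleO_pow_exp_pos_mul_atTop (k := 1) hlog).bound
    (c := 1 / (|C| + 1)) (by positivity)
  filter_upwards [ho, eventually_ge_atTop 2] with x hx hx2
  have hy : Real.exp (Real.log 2 / 2 * x) = (2 : ℝ) ^ (x / 2) := by
    rw [Real.rpow_def_of_pos two_pos]
    congr 1
    ring
  rw [hy, pow_one, Real.norm_of_nonneg (by linarith), Real.norm_of_nonneg (by positivity),
    one_div, inv_mul_eq_div, le_div_iff₀ (by positivity)] at hx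
  set y := (2 : ℝ) ^ (x / 2) with hydef
  have hsq : (2 : ℝ) ^ x = y * y := by
    rw [hydef, ← Real.rpow_add two_pos]
    congr 1
    ring
  have hC : C * x ≤ |C| * x := mul_le_mul_of_nonneg_right (le_abs_self C) (by linarith)
  have hy2 : 2 ≤ y := by nlinarith [abs_nonneg C]
  rw [hsq]
  nlinarith

/-! ### The lower bound -/

instance (N f : ℕ) : Finite (Chain N f) :=
  Finite.of_injective Chain.sets fun A B h => by
    cases A
    cases B
    congr

theorem mainTheorem4 (R δ : ℕ) (hδ : 1 ≤ δ) (hR : 2 * δ + 1 ≤ R) :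
    ∃ ε : ℕ → ℝ, ε =o[atTop] (fun _ : ℕ => (1 : ℝ)) ∧
      ∀ᶠ m : ℕ in atTop,
        ((graphZ m R δ).chromaticNumber.toNat : ℝ) >
          (2 : ℝ) ^ (((R : ℝ) - 2 * (δ : ℝ) - 4) / 2) * iterLog (2 * δ) (m : ℝ) + ε m := by
  -- With `s = R - 2 * δ - 1`, the constant is at most half of the factor `2 ^ s` gained by halving.
  -- This slack absorbs all lower-order terms, so the error term can be taken to be zero.
  refine ⟨fun _ => 0, isLittleO_zero _ _, ?_⟩
  obtain ⟨d, rfl⟩ : ∃ d, δ = d + 1 := ⟨δ - 1, by omega⟩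
  obtain ⟨s, rfl⟩ : ∃ s, R = 2 * d + 3 + s := ⟨R - (2 * d + 3), by omega⟩
  set C : ℝ := (2 : ℝ) ^ ((((2 * d + 3 + s : ℕ) : ℝ) - 2 * ((d + 1 : ℕ) : ℝ) - 4) / 2) with hC
  have hCpos : 0 < C := by positivity
  have hCle : C ≤ 2 ^ s / 2 := by
    rw [hC, ← Real.rpow_natCast, ← Real.rpow_sub_one two_ne_zero]
    refine Real.rpow_le_rpow_of_exponent_le one_le_two ?_
    push_cast
    have : (0 : ℝ) ≤ s := Nat.cast_nonneg s
    linarith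
  have hlim : ∀ j, Tendsto (fun m : ℕ => iterLog j (m : ℝ)) atTop atTop := fun j =>
    (tendsto_iterLog_atTop j).comp tendsto_natCast_atTop_atTop
  have hpos : ∀ᶠ m : ℕ in atTop, ∀ i ∈ Finset.range (2 * d + 2), 0 < iterLog i (m : ℝ) :=
    (Finset.eventually_all _).2 fun i _ => (hlim i).eventually_gt_atTop 0
  filter_upwards [hpos, eventually_ge_atTop (2 * d + 3 + s),
    (hlim (2 * (d + 1))).eventually (eventually_add_two_rpow_half_lt C)] with m hmpos hm hmL
  obtain ⟨c⟩ := SimpleGraph.colorable_chromaticNumber_of_fintype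
    (graphZ m (2 * d + 3 + s) (d + 1))
  set k := (graphZ m (2 * d + 3 + s) (d + 1)).chromaticNumber.toNat
  set L := iterLog (2 * (d + 1)) (m : ℝ) with hL
  rw [add_zero, gt_iff_lt]
  by_contra hk
  rw [not_lt] at hk
  have hbound := iterLog_le_of_le_iterate_two_pow (j := 2 * d + 1)
    (y := k + 1 + 2 ^ (k / 2 ^ s))
    (fun i hi => hmpos i (Finset.mem_range.2 (by omega)))
    (by
      rw [Function.iterate_succ_apply]
      exact le_iterate_two_pow_of_coloring hm c)
  have hLlog : (2 : ℝ) ^ L = iterLog (2 * d + 1) (m : ℝ) := by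
    have : L = Real.logb 2 (iterLog (2 * d + 1) (m : ℝ)) := by
      rw [hL, iterLog, iterLog, ← Function.iterate_succ_apply' (Real.logb 2)]
      rfl
    rw [this, Real.rpow_logb two_pos (by norm_num) (hmpos _ (Finset.mem_range.2 (by omega)))]
  have hLnonneg : 0 ≤ L := by
    have : 0 ≤ C * L := (Nat.cast_nonneg k).trans hk
    exact nonneg_of_mul_nonneg_right this hCpos
  have hdiv : ((k / 2 ^ s : ℕ) : ℝ) ≤ L / 2 := by
    refine Nat.cast_div_le.trans ?_
    push_cast
    rw [div_le_iff₀ (by positivity)]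
    calc (k : ℝ) ≤ C * L := hk
      _ ≤ 2 ^ s / 2 * L := mul_le_mul_of_nonneg_right hCle hLnonneg
      _ = L / 2 * 2 ^ s := by ring
  have hpow : (2 : ℝ) ^ (k / 2 ^ s : ℕ) ≤ (2 : ℝ) ^ (L / 2) := by
    rw [← Real.rpow_natCast]
    exact Real.rpow_le_rpow_of_exponent_le one_le_two hdiv
  push_cast at hbound
  rw [← hLlog] at hbound
  linarith
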